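/- Probabilistic non-adaptive group testing. There are $p$ items, and the defective set $S\subseteq\{1,\dots,p\}$ is uniformly distributed over the $\binom pk$ subsets of size $k$. A (possibly random) non-adaptive test design with $n$ tests is a random matrix $\mathbf X\in\{0,1\}^{n\times p}$, independent of $S$, where $X^{(i)}_j=1$ means that item $j$ is included in test $i$; the outcomes are $Y^{(i)}=\bigvee_{j\in S}X^{(i)}_j$ for $i=1,\dots,n$. A decoder maps $(\mathbf X,\mathbf Y)$ to an estimate $\widehat S\subseteq\{1,\dots,p\}$; design and decoder may depend on $p,k,n$. Theorem (Positive Result for Approximate Recovery). Fix $\alpha\in(0,1)$ and $\eta>0$. Let $k=k(p)\le p$ satisfy $k\to\infty$ and $k=o(p)$ as $p\to\infty$, and let $n=n(p)$ be integers such that, for all sufficiently large $p$, $$n\ \ge\ (1+\eta)(1-\alpha)\log_2\binom pk .$$ Then there exist, for each $p$, a non-adaptive test design with $n$ tests and a decoder whose estimate $\widehat S$ always has cardinality exactly $k$, such that, as $p\to\infty$, $$\mathbb P\Big[\max\big\{|\widehat S\setminus S|,\ |S\setminus\widehat S|\big\}\le\alpha k\Big]\to 1,$$ where the probability is over both $S$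 and $\mathbf X$. -/

import Mathlib

open Filter Topology
open scoped ENNReal

noncomputable section

namespace GroupTesting

/-- A test matrix for `n` non-adaptive tests on `p` items: the entry `X i j` says whether
item `j` is included in test `i`. -/
abbrev TestMatrix (n p : ℕ) : Type := Matrix (Fin n) (Fin p) Bool

/-- The outcomes `Y i = ⋁ j ∈ S, X i j` of the tests in `X` when `S` is the defective set. -/
def outcome {n p : ℕ} (X : TestMatrix n p) (S : Finset (Fin p)) : Fin n → Bool :=
  fun i => S.sup fun j => X i j

/-- A test is positive exactly when it includes a defective item. -/
theorem outcome_eq_true {n p : ℕ} (X : TestMatrix n p) (S : Finset (Fin p)) (i : Fin n) :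
    outcome X S i = true ↔ ∃ j ∈ S, X i j = true := by
  unfold outcome
  induction S using Finset.induction_on with
  | empty => simp
  | insert a s _ ih => simp [Finset.sup_insert, ih]

/-- A (possibly random) non-adaptive test design: a law of the whole test matrix. The matrix is
drawn independently of the defective set, before any outcome is seen; a deterministic design is
a point mass. -/
abbrev Design (n p : ℕ) : Type := PMF (TestMatrix n p)

/-- A decoder produces an estimate of the defective set from the test matrix and the outcomes. -/
abbrev Decoder (n p : ℕ) : Type := TestMatrix n p → (Fin n → Bool) → Finset (Fin p)

/-- The law of the defective set: uniform over the `p.choose k` subsets of size `k`. -/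
def defectiveLaw {k p : ℕ} (hk : k ≤ p) : PMF (Finset (Fin p)) :=
  PMF.uniformOfFinset (Finset.powersetCard k Finset.univ)
    (Finset.powersetCard_nonempty.2 (by simpa using hk))

/-- The joint law of the defective set and the test matrix, which are independent. -/
def jointLaw {n k p : ℕ} (hk : k ≤ p) (D : Design n p) : PMF (Finset (Fin p) × TestMatrix n p) :=
  (defectiveLaw hk).bind fun S => D.map fun X => (S, X)

/-- The approximate recovery criterion `max {|Ŝ \ S|, |S \ Ŝ|} ≤ α k` for an estimate `T` of `S`. -/
def ApproxRecovers {p : ℕ} (α : ℝ) (k : ℕ) (T S : Finset (Fin p)) : Prop :=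
  ((max (T \ S).card (S \ T).card : ℕ) : ℝ) ≤ α * k

/-- The probability, over the defective set and the test matrix, that the estimate satisfies the
approximate recovery criterion with parameter `α`. -/
def successProb {n k p : ℕ} (hk : k ≤ p) (D : Design n p) (dec : Decoder n p) (α : ℝ) : ℝ≥0∞ :=
  (jointLaw hk D).toOuterMeasure
    {ω | ApproxRecovers α k (dec ω.2 (outcome ω.2 ω.1)) ω.1}

end GroupTesting

end

noncomputable section

namespace GroupTesting

/-! Since αk defectives may be missed, it is enough to test a random set K of items that keeps
slightly more than a fraction 1 - α of them. By Chebyshev, K retains close to θk defectives for most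
S. Kept items enter tests independently, at a rate making (θ + ε)k items positive with probability
one half. Two sets of nearly that size then share an outcome in one test with probability at most r
^ m, m being the smaller of the two difference sizes (`collisionProb_le`). Writing ρ = k/p, the
hypothesis on n gives r ^ n ≤ ρ ^ (1 + h). One factor ρ ^ m nearly pays for the number of
competitors U in the union bound, and the surplus h beats what is left (`sum_collisionProb_pow_le`).
Hence any consistent set of plausible size, padded to k items, is a good estimate. Averaging fixes K
and the matrix, so the final design is a point mass. -/

/-- The probability of `x` when the entries are independent and each is `false` with
probability `r`. -/
def bernoulliWeight {ι : Type*} [Fintype ι] (r : ℝ) (x : ι → Bool) : ℝ :=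
  ∏ j, if x j then 1 - r else r

/-! ### Product Bernoulli weights and their moments -/

section Weight

variable {ι : Type*} [Fintype ι]

theorem bernoulliWeight_nonneg {r : ℝ} (h0 : 0 ≤ r) (h1 : r ≤ 1) (x : ι → Bool) :
    0 ≤ bernoulliWeight r x :=
  Finset.prod_nonneg fun j _ => by split_ifs <;> linarith

variable [DecidableEq ι]

theorem sum_bernoulliWeight_mul_prod (r : ℝ) (g : ι → Bool → ℝ) :
    ∑ x : ι → Bool, bernoulliWeight r x * ∏ j, g j (x j) =
      ∏ j, ((1 - r) * g j true + r * g j false) := by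
  have h := Finset.prod_univ_sum (fun _ : ι => (Finset.univ : Finset Bool))
    (fun j b => (if b then 1 - r else r) * g j b)
  simp only [Fintype.sum_bool, Fintype.piFinset_univ] at h
  simp only [bernoulliWeight, ← Finset.prod_mul_distrib]
  simpa using h.symm

theorem sum_bernoulliWeight (r : ℝ) : ∑ x : ι → Bool, bernoulliWeight r x = 1 := by
  have h := sum_bernoulliWeight_mul_prod r (fun (_ : ι) _ => 1)
  simpa using h

/-- The probability that all entries indexed by `U` are `false`. -/
theorem sum_bernoulliWeight_forall_false (r : ℝ) (U : Finset ι) :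
    ∑ x : ι → Bool, bernoulliWeight r x * (if ∀ j ∈ U, x j = false then 1 else 0) =
      r ^ U.card := by
  have h := sum_bernoulliWeight_mul_prod r
    (fun (j : ι) b => if j ∈ U → b = false then 1 else 0)
  have h2 : ∀ x : ι → Bool, (if ∀ j ∈ U, x j = false then (1 : ℝ) else 0) =
      ∏ j, if j ∈ U → x j = false then 1 else 0 := by
    intro x
    rw [Finset.prod_ite_zero]
    simp
  simp only [h2, h]
  rw [← Finset.prod_const, ← Finset.prod_subset (Finset.subset_univ U)]
  · exact Finset.prod_congr rfl fun j hj => by simp [hj]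
  · intro j _ hj
    simp [hj]

/-- Distinct coordinates are independent, so only the diagonal covariances survive. -/
theorem sum_bernoulliWeight_mul_centered (r : ℝ) (a b : ι) :
    ∑ x : ι → Bool, bernoulliWeight r x *
      (((if x a then 1 else 0) - (1 - r)) * ((if x b then 1 else 0) - (1 - r))) =
      if a = b then (1 - r) * r else 0 := by
  have h := sum_bernoulliWeight_mul_prod r (fun (j : ι) c =>
    (if j = a then ((if c then 1 else 0) - (1 - r)) else 1) *
      (if j = b then ((if c then 1 else 0) - (1 - r)) else 1))
  simp only [Finset.prod_mul_distrib, Finset.prod_ite_eq', Finset.mem_univ, if_true] at h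
  rw [h]
  by_cases hab : a = b
  · subst hab
    rw [if_pos rfl, Finset.prod_eq_single a]
    · simp; ring
    · intro j _ hj
      simp [hj]
    · simp
  · rw [if_neg hab]
    apply Finset.prod_eq_zero (Finset.mem_univ a)
    simp [hab]
    ring

/-- The variance of the number of `true` entries indexed by `S`. -/
theorem sum_bernoulliWeight_variance (r : ℝ) (S : Finset ι) :
    ∑ x : ι → Bool, bernoulliWeight r x *
      (((S.filter fun j => x j = true).card : ℝ) - (1 - r) * S.card) ^ 2 =
      S.card * ((1 - r) * r) := by
  have h : ∀ x : ι → Bool, bernoulliWeight r x *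
      (((S.filter fun j => x j = true).card : ℝ) - (1 - r) * S.card) ^ 2 =
      ∑ a ∈ S, ∑ b ∈ S, bernoulliWeight r x *
      (((if x a then 1 else 0) - (1 - r)) * ((if x b then 1 else 0) - (1 - r))) := by
    intro x
    have : ((S.filter fun j => x j = true).card : ℝ) - (1 - r) * S.card =
        ∑ a ∈ S, ((if x a then 1 else 0) - (1 - r)) := by
      rw [Finset.sum_sub_distrib, Finset.sum_boole]
      simp only [Finset.sum_const, nsmul_eq_mul]
      ring
    rw [this, sq, Finset.sum_mul_sum, Finset.mul_sum]
    simp only [Finset.mul_sum]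
  simp only [h]
  rw [Finset.sum_comm]
  have h3 : ∀ a ∈ S, ∑ x : ι → Bool, ∑ b ∈ S, bernoulliWeight r x *
      (((if x a then 1 else 0) - (1 - r)) * ((if x b then 1 else 0) - (1 - r))) =
      (1 - r) * r := by
    intro a ha
    rw [Finset.sum_comm]
    simp only [sum_bernoulliWeight_mul_centered, Finset.sum_ite_eq, ha, if_true]
  rw [Finset.sum_congr rfl h3]
  simp

end Weight

/-! ### Averaging, and the choice of kept items -/

/-- A weighted average of `f` bounds some value of `f` from above. -/
theorem exists_le_of_sum_mul_le {ι : Type*} [Fintype ι] {w f : ι → ℝ} {c : ℝ}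
    (hw : ∀ i, 0 ≤ w i) (hw1 : ∑ i, w i = 1) (h : ∑ i, w i * f i ≤ c) : ∃ i, f i ≤ c := by
  by_contra! hc
  obtain ⟨i, -, hi⟩ : ∃ i ∈ Finset.univ, 0 < w i :=
    Finset.exists_lt_of_sum_lt (by simp [hw1])
  have : ∑ i, w i * c < ∑ i, w i * f i :=
    Finset.sum_lt_sum (fun j _ => mul_le_mul_of_nonneg_left (hc j).le (hw j))
      ⟨i, Finset.mem_univ i, mul_lt_mul_of_pos_left (hc i) hi⟩
  rw [← Finset.sum_mul, hw1] at this
  linarith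

/-- Some set `K` of items contains close to a fraction `θ` of most of the sets in `F`. -/
theorem exists_concentrated_set {p k : ℕ} {θ ε : ℝ} (hθ0 : 0 ≤ θ) (hθ1 : θ ≤ 1) (hε : 0 < ε)
    (hk : 0 < k) (F : Finset (Finset (Fin p))) (hF : ∀ S ∈ F, S.card = k) :
    ∃ K : Fin p → Bool,
      ((F.filter fun S => ¬ |((S.filter fun j => K j = true).card : ℝ) - θ * k| ≤ ε * k).card : ℝ)
        ≤ F.card * (1 / (ε ^ 2 * k)) := by
  have hk' : (0 : ℝ) < k := by exact_mod_cast hk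
  apply exists_le_of_sum_mul_le (w := bernoulliWeight (1 - θ))
    (bernoulliWeight_nonneg (by linarith) (by linarith)) (sum_bernoulliWeight _)
  -- Chebyshev: the indicator of a large deviation is at most the squared deviation over (εk)².
  have h1 : ∀ x : Fin p → Bool, bernoulliWeight (1 - θ) x * ((F.filter fun S =>
      ¬ |((S.filter fun j => x j = true).card : ℝ) - θ * k| ≤ ε * k).card : ℝ) ≤
      ∑ S ∈ F, (1 / (ε * k) ^ 2) * (bernoulliWeight (1 - θ) x *
        (((S.filter fun j => x j = true).card : ℝ) - (1 - (1 - θ)) * S.card) ^ 2) := by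
    intro x
    rw [← Finset.sum_boole, Finset.mul_sum]
    refine Finset.sum_le_sum fun S hS => ?_
    have hw := bernoulliWeight_nonneg (r := 1 - θ) (by linarith) (by linarith) x
    rw [hF S hS, mul_left_comm, sub_sub_cancel]
    refine mul_le_mul_of_nonneg_left ?_ hw
    by_cases h : |((S.filter fun j => x j = true).card : ℝ) - θ * k| ≤ ε * k
    · rw [if_neg (not_not.2 h)]
      positivity
    · rw [if_pos h]
      rw [not_le] at h
      rw [one_div, inv_mul_eq_div, le_div_iff₀ (by positivity), one_mul, ← sq_abs (_ - _)]
      exact pow_le_pow_left₀ (by positivity) h.le 2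
  refine (Finset.sum_le_sum fun x _ => h1 x).trans ?_
  rw [Finset.sum_comm, ← nsmul_eq_mul]
  refine Finset.sum_le_card_nsmul _ _ _ fun S hS => ?_
  rw [← Finset.mul_sum, sum_bernoulliWeight_variance, hF S hS, sub_sub_cancel]
  have : θ * (1 - θ) ≤ 1 := by nlinarith
  calc 1 / (ε * k) ^ 2 * (k * (θ * (1 - θ))) ≤ 1 / (ε * k) ^ 2 * (k * 1) := by gcongr
    _ = 1 / (ε ^ 2 * k) := by field_simp

/-! ### Collisions of two sets -/

/-- The probability that a random test cannot tell `T` from `U`. -/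
def collisionProb {ι : Type*} [Fintype ι] [DecidableEq ι] (r : ℝ) (T U : Finset ι) : ℝ :=
  ∑ x : ι → Bool, bernoulliWeight r x *
    (if (∀ j ∈ T, x j = false) ↔ ∀ j ∈ U, x j = false then 1 else 0)

theorem collisionProb_eq {ι : Type*} [Fintype ι] [DecidableEq ι] (r : ℝ) (T U : Finset ι) :
    collisionProb r T U = 1 - r ^ T.card - r ^ U.card + 2 * r ^ (T ∪ U).card := by
  rw [← sum_bernoulliWeight (ι := ι) r, ← sum_bernoulliWeight_forall_false r T,
    ← sum_bernoulliWeight_forall_false r U, ← sum_bernoulliWeight_forall_false r (T ∪ U),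
    Finset.mul_sum, ← Finset.sum_sub_distrib, ← Finset.sum_sub_distrib,
    ← Finset.sum_add_distrib, collisionProb]
  refine Finset.sum_congr rfl fun x _ => ?_
  simp only [Finset.forall_mem_union]
  split_ifs <;> first | ring1 | (exfalso; tauto)

theorem collisionProb_nonneg {ι : Type*} [Fintype ι] [DecidableEq ι] {r : ℝ} (h0 : 0 ≤ r)
    (h1 : r ≤ 1) (T U : Finset ι) : 0 ≤ collisionProb r T U :=
  Finset.sum_nonneg fun x _ => mul_nonneg (bernoulliWeight_nonneg h0 h1 x) (by positivity)

/-- With a = |T \ U| and b = |U \ T|, the exact formula is 1 - r^|U| (1 - r^a) - r^|T| (1 - r^b).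
Replacing both outer powers by 1/2 leaves (r^a + r^b)/2. -/
theorem collisionProb_le {ι : Type*} [Fintype ι] [DecidableEq ι] {r : ℝ} (h0 : 0 ≤ r)
    (h1 : r ≤ 1) {T U : Finset ι} (hT : 1 / 2 ≤ r ^ T.card) (hU : 1 / 2 ≤ r ^ U.card) {m : ℕ}
    (hTU : m ≤ (T \ U).card) (hUT : m ≤ (U \ T).card) : collisionProb r T U ≤ r ^ m := by
  have e1 : r ^ (T ∪ U).card = r ^ U.card * r ^ (T \ U).card := by
    rw [← pow_add, ← Finset.card_sdiff_add_card T U, add_comm]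
  have e2 : r ^ (T ∪ U).card = r ^ T.card * r ^ (U \ T).card := by
    rw [← pow_add, Finset.union_comm, ← Finset.card_sdiff_add_card U T, add_comm]
  have b1 := pow_le_pow_of_le_one h0 h1 hTU
  have b2 := pow_le_pow_of_le_one h0 h1 hUT
  have c1 : r ^ (T \ U).card ≤ 1 := pow_le_one₀ h0 h1
  have c2 : r ^ (U \ T).card ≤ 1 := pow_le_one₀ h0 h1
  have d1 := mul_le_mul_of_nonneg_right hU (sub_nonneg.2 c1)
  have d2 := mul_le_mul_of_nonneg_right hT (sub_nonneg.2 c2)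
  rw [collisionProb_eq]
  linarith

theorem outcome_eq_outcome_iff {n p : ℕ} (X : TestMatrix n p) (T U : Finset (Fin p)) :
    outcome X T = outcome X U ↔
      ∀ i, (∀ j ∈ T, X i j = false) ↔ ∀ j ∈ U, X i j = false := by
  have h : ∀ (V : Finset (Fin p)) i, (∀ j ∈ V, X i j = false) ↔ outcome X V i ≠ true := by
    intro V i
    rw [ne_eq, outcome_eq_true]
    simp
  simp only [h, not_iff_not, ne_eq]
  rw [funext_iff]
  exact forall_congr' fun i => Bool.eq_iff_iff

/-- Averaging over random matrices: few members of `F` are confused with a candidate. -/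
theorem exists_matrix_few_collisions {α : Type*} {n p : ℕ} {r : ℝ} (h0 : 0 ≤ r) (h1 : r ≤ 1)
    (F : Finset α) (T : α → Finset (Fin p)) (C : α → Finset (Finset (Fin p))) {c : ℝ}
    (h : ∀ S ∈ F, ∑ U ∈ C S, collisionProb r (T S) U ^ n ≤ c) :
    ∃ X : TestMatrix n p,
      ((F.filter fun S => ∃ U ∈ C S, outcome X (T S) = outcome X U).card : ℝ) ≤ F.card * c := by
  have key : ∀ f : (Fin p → Bool) → ℝ,
      ∑ X : TestMatrix n p, ∏ i, f (X i) = (∑ x, f x) ^ n := by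
    intro f
    have := Finset.prod_univ_sum (fun _ : Fin n => (Finset.univ : Finset (Fin p → Bool)))
      (fun _ x => f x)
    rw [Finset.prod_const, Finset.card_univ, Fintype.card_fin, Fintype.piFinset_univ] at this
    exact this.symm
  have hw : ∀ X : TestMatrix n p, 0 ≤ ∏ i, bernoulliWeight r (X i) := fun X =>
    Finset.prod_nonneg fun i _ => bernoulliWeight_nonneg h0 h1 _
  apply exists_le_of_sum_mul_le (w := fun X : TestMatrix n p => ∏ i, bernoulliWeight r (X i)) hw
  · rw [key, sum_bernoulliWeight, one_pow]
  have hX : ∀ X : TestMatrix n p, (∏ i, bernoulliWeight r (X i)) *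
      ((F.filter fun S => ∃ U ∈ C S, outcome X (T S) = outcome X U).card : ℝ) ≤
      ∑ S ∈ F, ∑ U ∈ C S, ∏ i, (bernoulliWeight r (X i) *
        (if (∀ j ∈ T S, X i j = false) ↔ ∀ j ∈ U, X i j = false then 1 else 0)) := by
    intro X
    rw [← Finset.sum_boole, Finset.mul_sum]
    refine Finset.sum_le_sum fun S _ => ?_
    simp only [Finset.prod_mul_distrib, ← Finset.mul_sum, Finset.prod_ite_zero,
      Finset.prod_const_one, Finset.mem_univ, true_implies, ← outcome_eq_outcome_iff]
    refine mul_le_mul_of_nonneg_left ?_ (hw X)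
    split_ifs with hS
    · obtain ⟨U, hU, hSU⟩ := hS
      exact (by simp [hSU] : (1 : ℝ) ≤ if outcome X (T S) = outcome X U then 1 else 0).trans
        (Finset.single_le_sum (f := fun U => if outcome X (T S) = outcome X U then (1 : ℝ) else 0)
          (fun V _ => by positivity) hU)
    · positivity
  refine (Finset.sum_le_sum fun X _ => hX X).trans ?_
  rw [Finset.sum_comm, ← nsmul_eq_mul]
  refine Finset.sum_le_card_nsmul _ _ _ fun S hS => ?_
  rw [Finset.sum_comm]
  refine le_trans (le_of_eq ?_) (h S hS)
  refine Finset.sum_congr rfl fun U _ => ?_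
  unfold collisionProb
  convert key fun x => bernoulliWeight r x *
    (if (∀ j ∈ T S, x j = false) ↔ ∀ j ∈ U, x j = false then 1 else 0)

/-! ### The union bound over competitors -/

/-- The sum factors over items: 2 for each item of T, and 1 + ρ ≤ exp ρ for each other item. -/
theorem sum_pow_card_sdiff_le {ι : Type*} [Fintype ι] [DecidableEq ι] {ρ : ℝ} (hρ : 0 ≤ ρ)
    (T : Finset ι) :
    ∑ U : Finset ι, ρ ^ (U \ T).card ≤ 2 ^ T.card * Real.exp (ρ * Fintype.card ι) := by
  have h := Finset.prod_one_add (f := fun j => if j ∈ T then (1 : ℝ) else ρ) Finset.univ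
  have h2 : ∀ U : Finset ι, ∏ j ∈ U, (if j ∈ T then (1 : ℝ) else ρ) = ρ ^ (U \ T).card := by
    intro U
    rw [Finset.prod_ite, Finset.prod_const_one, one_mul, Finset.prod_const,
      Finset.sdiff_eq_filter]
  rw [Finset.powerset_univ] at h
  simp only [h2] at h
  rw [← h]
  calc ∏ j, (1 + if j ∈ T then (1 : ℝ) else ρ)
      ≤ ∏ j : ι, ((if j ∈ T then 2 else 1) * Real.exp ρ) := by
        refine Finset.prod_le_prod (fun j _ => by positivity) fun j _ => ?_
        split_ifs
        · linarith [Real.one_le_exp hρ]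
        · linarith [Real.add_one_le_exp ρ]
    _ = 2 ^ T.card * Real.exp (ρ * Fintype.card ι) := by
        rw [Finset.prod_mul_distrib, Finset.prod_ite_mem, Finset.univ_inter, Finset.prod_const,
          Finset.prod_const, Finset.card_univ, ← Real.exp_nat_mul, mul_comm ρ]

theorem collisionProb_pow_le {p k n : ℕ} {r ρ θ ε τ h γ : ℝ} (hr0 : 0 < r) (hr1 : r ≤ 1)
    (hρ0 : 0 < ρ) (hρ1 : ρ ≤ 1) (hh : 0 ≤ h)
    (hγ : γ ≤ h * (τ - 2 * ε) - 2 * ε)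
    (hr : ∀ c : ℕ, (c : ℝ) ≤ (θ + ε) * k → 1 / 2 ≤ r ^ c) (hrn : r ^ n ≤ ρ ^ (1 + h))
    {T U : Finset (Fin p)} (hT : |(T.card : ℝ) - θ * k| ≤ ε * k)
    (hU : |(U.card : ℝ) - θ * k| ≤ ε * k) (hTU : τ * k < ((T \ U).card : ℝ)) :
    collisionProb r T U ^ n ≤ ρ ^ (U \ T).card * (ρ ^ γ) ^ k := by
  rw [abs_le] at hT hU
  -- Both sizes lie within εk of θk, so the two differences have sizes at most 2εk apart.
  have hcard : (T.card : ℝ) + (U \ T).card = U.card + (T \ U).card := by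
    have h1 := Finset.card_sdiff_add_card T U
    have h2 := Finset.card_sdiff_add_card U T
    rw [Finset.union_comm] at h2
    exact_mod_cast (by omega : T.card + (U \ T).card = U.card + (T \ U).card)
  set m := min (T \ U).card (U \ T).card with hm
  have hmb : ((U \ T).card : ℝ) - 2 * ε * k ≤ m := by
    rw [hm, Nat.cast_min]
    refine le_min ?_ ?_ <;> nlinarith
  have hma : ((T \ U).card : ℝ) - 2 * ε * k ≤ m := by
    rw [hm, Nat.cast_min]
    refine le_min ?_ ?_ <;> nlinarith
  have hP := collisionProb_le hr0.le hr1 (hr _ (by nlinarith : (T.card : ℝ) ≤ (θ + ε) * k))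
    (hr _ (by nlinarith : (U.card : ℝ) ≤ (θ + ε) * k)) (min_le_left _ _) (min_le_right _ _)
  calc collisionProb r T U ^ n ≤ (r ^ m) ^ n :=
        pow_le_pow_left₀ (collisionProb_nonneg hr0.le hr1 T U) hP n
    _ = (r ^ n) ^ m := pow_right_comm r m n
    _ ≤ (ρ ^ (1 + h)) ^ m := pow_le_pow_left₀ (by positivity) hrn m
    _ = ρ ^ ((1 + h) * m) := by rw [← Real.rpow_natCast, ← Real.rpow_mul hρ0.le]
    _ ≤ ρ ^ (((U \ T).card : ℝ) + γ * k) := by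
        -- Split (1 + h)m as m + hm: the first is at least |U \ T| - 2εk, the second at least h(τ -
        -- 2ε)k.
        apply Real.rpow_le_rpow_of_exponent_ge hρ0 hρ1
        have h1 : (τ - 2 * ε) * k ≤ m := by linarith
        have h2 := mul_le_mul_of_nonneg_left h1 hh
        have h3 := mul_le_mul_of_nonneg_right hγ (Nat.cast_nonneg (α := ℝ) k)
        linarith
    _ = ρ ^ (U \ T).card * (ρ ^ γ) ^ k := by
        rw [Real.rpow_add hρ0, Real.rpow_natCast, Real.rpow_mul hρ0.le, Real.rpow_natCast]

theorem sum_collisionProb_pow_le {p k n : ℕ} {r θ ε τ h γ : ℝ} (hk : 0 < k) (hkp : k ≤ p)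
    (hr0 : 0 < r) (hr1 : r ≤ 1) (hh : 0 ≤ h) (hγ : γ ≤ h * (τ - 2 * ε) - 2 * ε)
    (hr : ∀ c : ℕ, (c : ℝ) ≤ (θ + ε) * k → 1 / 2 ≤ r ^ c)
    (hrn : r ^ n ≤ ((k : ℝ) / p) ^ (1 + h)) {T : Finset (Fin p)}
    (hT : |(T.card : ℝ) - θ * k| ≤ ε * k) (hTk : T.card ≤ k) :
    ∑ U : Finset (Fin p) with |(U.card : ℝ) - θ * k| ≤ ε * k ∧ τ * k < ((T \ U).card : ℝ),
      collisionProb r T U ^ n ≤ (2 * Real.exp 1 * ((k : ℝ) / p) ^ γ) ^ k := by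
  have hp' : (0 : ℝ) < p := by exact_mod_cast hk.trans_le hkp
  have hk' : (0 : ℝ) < k := by exact_mod_cast hk
  have hρ0 : 0 < (k : ℝ) / p := by positivity
  have hρ1 : (k : ℝ) / p ≤ 1 := (div_le_one hp').2 (by exact_mod_cast hkp)
  set ρ := (k : ℝ) / p with hρ
  calc _ ≤ ∑ U : Finset (Fin p) with
        |(U.card : ℝ) - θ * k| ≤ ε * k ∧ τ * k < ((T \ U).card : ℝ),
        ρ ^ (U \ T).card * (ρ ^ γ) ^ k := by
        refine Finset.sum_le_sum fun U hU => ?_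
        rw [Finset.mem_filter] at hU
        exact collisionProb_pow_le hr0 hr1 hρ0 hρ1 hh hγ hr hrn hT hU.2.1 hU.2.2
    _ ≤ ∑ U : Finset (Fin p), ρ ^ (U \ T).card * (ρ ^ γ) ^ k :=
        Finset.sum_le_univ_sum_of_nonneg fun U => by positivity
    _ ≤ (2 ^ T.card * Real.exp (ρ * Fintype.card (Fin p))) * (ρ ^ γ) ^ k := by
        rw [← Finset.sum_mul]
        exact mul_le_mul_of_nonneg_right (sum_pow_card_sdiff_le hρ0.le T) (by positivity)
    _ ≤ (2 ^ k * Real.exp 1 ^ k) * (ρ ^ γ) ^ k := by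
        rw [Fintype.card_fin, hρ, div_mul_cancel₀ _ hp'.ne', ← Real.exp_nat_mul, mul_one]
        gcongr
        norm_num
    _ = _ := by rw [mul_pow, mul_pow]

/-- Per-test survival probability `r` making a set of `s` items hit a test with probability
one half. -/
theorem exists_rate {n : ℕ} {s h ρ : ℝ} (hs : 0 < s) (hρ0 : 0 < ρ)
    (hn : (1 + h) * s * Real.logb 2 (1 / ρ) ≤ n) :
    ∃ r : ℝ, 0 < r ∧ r ≤ 1 ∧ (∀ c : ℕ, (c : ℝ) ≤ s → 1 / 2 ≤ r ^ c) ∧ r ^ n ≤ ρ ^ (1 + h) := by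
  have h2 : (1 : ℝ) ≤ 2 := by norm_num
  -- This r solves r ^ s = 1/2.
  refine ⟨2 ^ (-(1 / s)), by positivity,
    Real.rpow_le_one_of_one_le_of_nonpos h2 (by simp [hs.le]), fun c hc => ?_, ?_⟩
  · rw [← Real.rpow_natCast, ← Real.rpow_mul (by norm_num)]
    have : (1 / 2 : ℝ) = 2 ^ (-1 : ℝ) := by rw [Real.rpow_neg_one]; norm_num
    rw [this]
    apply Real.rpow_le_rpow_of_exponent_le h2
    rw [neg_mul, neg_le_neg_iff, one_div_mul_eq_div]
    exact (div_le_one hs).2 hc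
  · rw [← Real.rpow_natCast, ← Real.rpow_mul (by norm_num)]
    have : ρ ^ (1 + h) = 2 ^ (-((1 + h) * Real.logb 2 (1 / ρ))) := by
      rw [one_div, Real.logb_inv, mul_neg, neg_neg, mul_comm, Real.rpow_mul (by norm_num),
        Real.rpow_logb (by norm_num) (by norm_num) hρ0]
    rw [this]
    apply Real.rpow_le_rpow_of_exponent_le h2
    rw [neg_mul, neg_le_neg_iff, one_div_mul_eq_div, le_div_iff₀ hs]
    linarith

/-! ### Masking and decoding -/

/-- The test matrix `X` restricted to the items in `K`. -/
def mask {n p : ℕ} (K : Fin p → Bool) (X : TestMatrix n p) : TestMatrix n p :=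
  fun i j => X i j && K j

theorem outcome_mask {n p : ℕ} (K : Fin p → Bool) (X : TestMatrix n p) (S : Finset (Fin p)) :
    outcome (mask K X) S = outcome X (S.filter fun j => K j = true) := by
  funext i
  rw [Bool.eq_iff_iff, outcome_eq_true, outcome_eq_true]
  simp only [mask, Bool.and_eq_true, Finset.mem_filter]
  exact exists_congr fun j => by tauto

/-- Pick any admissible set explaining the outcomes and pad it to k items; padding cannot increase
the number of missed defectives. -/
theorem exists_decoder_of_consistency {n p k : ℕ} (hkp : k ≤ p) (X : TestMatrix n p)
    (R : Finset (Fin p) → Prop) (hR : ∀ U, R U → U.card ≤ k) :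
    ∃ dec : (Fin n → Bool) → Finset (Fin p), (∀ y, (dec y).card = k) ∧
      ∀ T, R T → ∃ U ⊆ dec (outcome X T), R U ∧ outcome X T = outcome X U := by
  have h : ∀ y : Fin n → Bool, ∃ V : Finset (Fin p), V.card = k ∧
      ∀ T, R T → outcome X T = y → ∃ U ⊆ V, R U ∧ y = outcome X U := by
    intro y
    by_cases hy : ∃ U, R U ∧ y = outcome X U
    · obtain ⟨U, hU, hyU⟩ := hy
      obtain ⟨V, hUV, hV⟩ := Finset.exists_superset_card_eq (hR U hU)
        (by simpa using hkp : k ≤ Fintype.card (Fin p))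
      exact ⟨V, hV, fun T _ _ => ⟨U, hUV, hU, hyU⟩⟩
    · obtain ⟨V, -, hV⟩ := Finset.exists_superset_card_eq
        (by simp : (∅ : Finset (Fin p)).card ≤ k) (by simpa using hkp : k ≤ Fintype.card (Fin p))
      exact ⟨V, hV, fun T hT hTy => absurd ⟨T, hT, hTy.symm⟩ hy⟩
  choose dec h1 h2 using h
  exact ⟨dec, h1, fun T hT => h2 _ T hT rfl⟩

theorem approxRecovers_of_card_sdiff_le {p k : ℕ} {α : ℝ} {T S : Finset (Fin p)}
    (hT : T.card = k) (hS : S.card = k) (h : ((S \ T).card : ℝ) ≤ α * k) :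
    ApproxRecovers α k T S := by
  rw [ApproxRecovers, Finset.card_sdiff_comm (hT.trans hS.symm), max_self]
  exact h

open Classical in
/-- A fixed design and decoder that fail for few defective sets. -/
theorem exists_matrix_decoder {p k n : ℕ} {α θ ε τ h γ : ℝ} (hk : 0 < k) (hkp : k ≤ p)
    (hθ : 0 ≤ θ) (hε : 0 < ε) (hθε : θ + ε ≤ 1) (hα : 1 - θ + ε + τ ≤ α) (hh : 0 ≤ h)
    (hγ : γ ≤ h * (τ - 2 * ε) - 2 * ε)
    (hn : (1 + h) * ((θ + ε) * k) * Real.logb 2 (1 / ((k : ℝ) / p)) ≤ n) :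
    ∃ (X : TestMatrix n p) (dec : (Fin n → Bool) → Finset (Fin p)),
      (∀ y, (dec y).card = k) ∧
      (((Finset.powersetCard k Finset.univ).filter
        fun S => ¬ ApproxRecovers α k (dec (outcome X S)) S).card : ℝ) ≤
        p.choose k * (1 / (ε ^ 2 * k) + (2 * Real.exp 1 * ((k : ℝ) / p) ^ γ) ^ k) := by
  have hp' : (0 : ℝ) < p := by exact_mod_cast hk.trans_le hkp
  have hk' : (0 : ℝ) < k := by exact_mod_cast hk
  set F : Finset (Finset (Fin p)) := Finset.powersetCard k Finset.univ with hFdef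
  have hF : ∀ S ∈ F, S.card = k := fun S hS => (Finset.mem_powersetCard.1 hS).2
  have hFc : F.card = p.choose k := by simp [hFdef]
  obtain ⟨r, hr0, hr1, hr, hrn⟩ := exists_rate (s := (θ + ε) * k) (by positivity)
    (by positivity : 0 < (k : ℝ) / p) hn
  obtain ⟨K, hK⟩ := exists_concentrated_set hθ (by linarith) hε hk F hF
  set c : ℝ := (2 * Real.exp 1 * ((k : ℝ) / p) ^ γ) ^ k with hc
  let κ : Finset (Fin p) → Finset (Fin p) := fun S => S.filter fun j => K j = true
  let R : Finset (Fin p) → Prop := fun U => |(U.card : ℝ) - θ * k| ≤ ε * k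
  have hκ : ∀ S ∈ F, (κ S).card ≤ k := fun S hS => (Finset.card_filter_le _ _).trans_eq (hF S hS)
  obtain ⟨X, hX⟩ := exists_matrix_few_collisions (n := n) hr0.le hr1 (F.filter fun S => R (κ S)) κ
    (fun S => Finset.univ.filter fun U => R U ∧ τ * k < ((κ S \ U).card : ℝ)) (c := c)
    (fun S hS => sum_collisionProb_pow_le hk hkp hr0 hr1 hh hγ hr hrn
      (Finset.mem_filter.1 hS).2 (hκ S (Finset.mem_filter.1 hS).1))
  obtain ⟨dec, hdec, hdec2⟩ := exists_decoder_of_consistency hkp X R (fun U hU => by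
    have h1 := (abs_le.1 hU).2
    have h2 := mul_le_mul_of_nonneg_right hθε hk'.le
    exact_mod_cast (by linarith : (U.card : ℝ) ≤ k))
  refine ⟨mask K X, dec, hdec, ?_⟩
  -- Failure has two causes: K keeps an atypical number of defectives, or the kept ones collide with
  -- a plausible set missing more than τk of them.
  have hsub : F.filter (fun S => ¬ ApproxRecovers α k (dec (outcome (mask K X) S)) S) ⊆
      F.filter (fun S => ¬ R (κ S)) ∪ (F.filter fun S => R (κ S)).filter (fun S =>
        ∃ U ∈ Finset.univ.filter fun U => R U ∧ τ * k < ((κ S \ U).card : ℝ),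
          outcome X (κ S) = outcome X U) := by
    intro S hS
    rw [Finset.mem_filter] at hS
    obtain ⟨hSF, hS⟩ := hS
    by_contra hcon
    rw [Finset.mem_union, not_or] at hcon
    obtain ⟨hcon1, hcon2⟩ := hcon
    have hRS : R (κ S) := by
      by_contra hRS
      exact hcon1 (Finset.mem_filter.2 ⟨hSF, hRS⟩)
    obtain ⟨U, hU, hRU, hUo⟩ := hdec2 (κ S) hRS
    have hSU : ((κ S \ U).card : ℝ) ≤ τ * k := by
      by_contra hlt
      refine hcon2 ?_
      simp only [Finset.mem_filter]
      exact ⟨⟨hSF, hRS⟩, U, ⟨Finset.mem_univ U, hRU, not_le.1 hlt⟩, hUo⟩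
    apply hS
    apply approxRecovers_of_card_sdiff_le (hdec _) (hF S hSF)
    rw [outcome_mask]
    -- A missed defective was either discarded by the mask or absent from the chosen U.
    have h1 : (S \ dec (outcome X (κ S))).card ≤ (S \ κ S).card + (κ S \ U).card := by
      refine (Finset.card_le_card ?_).trans (Finset.card_union_le _ _)
      intro j hj
      simp only [Finset.mem_sdiff, Finset.mem_union] at hj ⊢
      by_cases hjK : j ∈ κ S
      · exact Or.inr ⟨hjK, fun hjU => hj.2 (hU hjU)⟩
      · exact Or.inl ⟨hj.1, hjK⟩
    have h2 : (S \ κ S).card + (κ S).card = k := by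
      rw [Finset.card_sdiff_add_card_eq_card (Finset.filter_subset _ _), hF S hSF]
    have h1' : ((S \ dec (outcome X (κ S))).card : ℝ) ≤ (S \ κ S).card + (κ S \ U).card := by
      exact_mod_cast h1
    have h2' : ((S \ κ S).card : ℝ) + (κ S).card = k := by exact_mod_cast h2
    have h3 := (abs_le.1 hRS).1
    have h4 := mul_le_mul_of_nonneg_right hα hk'.le
    change ((S \ dec (outcome X (κ S))).card : ℝ) ≤ α * k
    linarith
  have hcard := (Finset.card_le_card hsub).trans (Finset.card_union_le _ _)
  have hcR := (Nat.cast_le (α := ℝ)).2 hcard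
  rw [Nat.cast_add] at hcR
  have hle : ((F.filter fun S => R (κ S)).card : ℝ) * c ≤ F.card * c := by
    have : 0 ≤ c := by positivity
    gcongr
    exact Finset.filter_subset _ _
  rw [← hFc, mul_add]
  refine hcR.trans (add_le_add hK (le_trans (le_of_eq ?_) (hX.trans hle)))
  congr!

/-! ### From counts to probabilities, and the constants -/

open Classical in
/-- The success probability of a deterministic design, from a count of its failures. -/
theorem le_successProb_pure {n k p : ℕ} (hk : k ≤ p) (X : TestMatrix n p) (dec : Decoder n p)
    {α δ : ℝ} (h : (((Finset.powersetCard k Finset.univ).filter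
      fun S => ¬ ApproxRecovers α k (dec X (outcome X S)) S).card : ℝ) ≤ p.choose k * δ) :
    ENNReal.ofReal (1 - δ) ≤ successProb hk (PMF.pure X) dec α := by
  have hj : jointLaw hk (PMF.pure X) = (defectiveLaw hk).map fun S => (S, X) := by
    simp only [jointLaw, PMF.pure_map]
    rfl
  have hpos : (0 : ℝ) < p.choose k := by exact_mod_cast Nat.choose_pos hk
  have hc : (Finset.powersetCard k (Finset.univ : Finset (Fin p))).card = p.choose k := by simp
  have hsplit := Finset.card_filter_add_card_filter_not
    (s := Finset.powersetCard k (Finset.univ : Finset (Fin p)))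
    (fun S => ApproxRecovers α k (dec X (outcome X S)) S)
  rw [hc] at hsplit
  have hsplit' : ((((Finset.powersetCard k (Finset.univ : Finset (Fin p))).filter
      fun S => ApproxRecovers α k (dec X (outcome X S)) S).card : ℝ)) +
      (((Finset.powersetCard k (Finset.univ : Finset (Fin p))).filter
      fun S => ¬ ApproxRecovers α k (dec X (outcome X S)) S).card : ℝ) = p.choose k := by
    exact_mod_cast hsplit
  rw [successProb, hj, PMF.toOuterMeasure_map_apply, defectiveLaw,
    PMF.toOuterMeasure_uniformOfFinset_apply, hc]
  have hval : 1 - δ ≤ (((Finset.powersetCard k (Finset.univ : Finset (Fin p))).filter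
      fun S => ApproxRecovers α k (dec X (outcome X S)) S).card : ℝ) / p.choose k := by
    rw [le_div_iff₀ hpos]
    linarith
  refine (ENNReal.ofReal_le_ofReal hval).trans_eq ?_
  rw [ENNReal.ofReal_div_of_pos hpos, ENNReal.ofReal_natCast, ENNReal.ofReal_natCast]
  rfl

theorem successProb_le_one {n k p : ℕ} (hk : k ≤ p) (D : Design n p) (dec : Decoder n p)
    (α : ℝ) : successProb hk D dec α ≤ 1 :=
  ((jointLaw hk D).toOuterMeasure.mono (Set.subset_univ _)).trans_eq
    ((PMF.toOuterMeasure_apply_eq_one_iff _ _).2 (Set.subset_univ _))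

/-- Induction by absorption, using (p + 1)/(k + 1) ≤ p/k. -/
theorem div_pow_le_choose {k p : ℕ} (hk : k ≤ p) : ((p : ℝ) / k) ^ k ≤ p.choose k := by
  induction k generalizing p with
  | zero => simp
  | succ k ih =>
    obtain ⟨p, rfl⟩ : ∃ q, p = q + 1 := ⟨p - 1, by omega⟩
    have hkp : k ≤ p := by omega
    have h1 : ((p + 1 : ℕ) : ℝ) * p.choose k = (p + 1).choose (k + 1) * ((k + 1 : ℕ) : ℝ) := by
      exact_mod_cast Nat.add_one_mul_choose_eq p k
    have h2 : ((p + 1).choose (k + 1) : ℝ) =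
        ((p + 1 : ℕ) : ℝ) / ((k + 1 : ℕ) : ℝ) * p.choose k := by
      field_simp
      linarith
    rw [h2, pow_succ']
    refine mul_le_mul_of_nonneg_left (le_trans ?_ (ih hkp)) (by positivity)
    rcases Nat.eq_zero_or_pos k with rfl | hk0
    · simp
    · have hk0' : (0 : ℝ) < k := by exact_mod_cast hk0
      have hkp' : (k : ℝ) ≤ p := by exact_mod_cast hkp
      refine pow_le_pow_left₀ (by positivity) ?_ k
      rw [div_le_div_iff₀ (by positivity) hk0']
      push_cast
      nlinarith

theorem mul_logb_le_logb_choose {k p : ℕ} (hk0 : 0 < k) (hk : k ≤ p) :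
    k * Real.logb 2 (1 / ((k : ℝ) / p)) ≤ Real.logb 2 (p.choose k) := by
  have hp0 : 0 < p := by omega
  rw [one_div_div, ← Real.logb_pow]
  exact Real.logb_le_logb_of_le (by norm_num) (by positivity) (div_pow_le_choose hk)

/-- The tolerances used by the scheme: a fraction `θ ± ε` of the defective items is kept, and a
fraction `τ` of the defective items may be missed among the kept ones. -/
theorem exists_tolerances {α η : ℝ} (hα0 : 0 < α) (hα1 : α < 1) (hη : 0 < η) :
    ∃ θ ε τ h γ : ℝ, 0 ≤ θ ∧ 0 < ε ∧ θ + ε ≤ 1 ∧ 1 - θ + ε + τ ≤ α ∧ 0 ≤ h ∧ 0 < γ ∧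
      γ ≤ h * (τ - 2 * ε) - 2 * ε ∧ (1 + h) * (θ + ε) ≤ (1 + η) * (1 - α) := by
  set h := η / 2 with hh
  have hh0 : 0 < h := by positivity
  have h1 : 0 < 1 - α := by linarith
  set τ := min (α / 2) (h * (1 - α) / (2 * (1 + h))) with hτ
  have hτ0 : 0 < τ := lt_min (by positivity) (by positivity)
  have hτ1 : τ ≤ α / 2 := min_le_left _ _
  have hτ2 : τ * (2 * (1 + h)) ≤ h * (1 - α) :=
    (le_div_iff₀ (by positivity)).1 (min_le_right _ _)
  set ε := h * τ / (4 * (1 + h)) with hεd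
  have hε0 : 0 < ε := by positivity
  have hε1 : ε * (4 * (1 + h)) = h * τ := div_mul_cancel₀ _ (by positivity)
  have hε2 : 2 * ε ≤ τ := by nlinarith
  -- θ exhausts the budget α exactly, and ε makes h(τ - 2ε) - 2ε equal to hτ/2. The bound on τ keeps
  -- the rate below (1 + 2h)(1 - α).
  refine ⟨1 - α + ε + τ, ε, τ, h, h * τ / 2, by linarith, hε0, by linarith, by linarith, hh0.le,
    by positivity, by nlinarith, ?_⟩
  have : (1 + h) * (2 * ε + τ) ≤ (1 + h) * (2 * τ) :=
    mul_le_mul_of_nonneg_left (by linarith) (by positivity)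
  have hηh : η = 2 * h := by rw [hh]; ring
  rw [hηh]
  nlinarith

end GroupTesting

end

/-! ### Assembly and limits -/

theorem mainTheorem3 (α η : ℝ) (hα0 : 0 < α) (hα1 : α < 1) (hη : 0 < η)
    (k n : ℕ → ℕ) (hkp : ∀ p, k p ≤ p)
    (hk : Tendsto k atTop atTop)
    (hko : Asymptotics.IsLittleO atTop (fun p => (k p : ℝ)) (fun p : ℕ => (p : ℝ)))
    (hn : ∀ᶠ p in atTop, (1 + η) * (1 - α) * Real.logb 2 (p.choose (k p) : ℝ) ≤ (n p : ℝ)) :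
    ∃ (D : ∀ p, GroupTesting.Design (n p) p) (dec : ∀ p, GroupTesting.Decoder (n p) p),
      (∀ p X y, (dec p X y).card = k p) ∧
      Tendsto (fun p => GroupTesting.successProb (hkp p) (D p) (dec p) α) atTop (𝓝 1) := by
  obtain ⟨θ, ε, τ, h, γ, hθ, hε, hθε, hα, hh, hγ0, hγ, hrate⟩ :=
    GroupTesting.exists_tolerances hα0 hα1 hη
  let δ : ℕ → ℝ := fun p =>
    1 / (ε ^ 2 * k p) + (2 * Real.exp 1 * ((k p : ℝ) / p) ^ γ) ^ k p
  have hgood : ∀ p, ∃ (D : GroupTesting.Design (n p) p) (dec : GroupTesting.Decoder (n p) p),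
      (∀ X y, (dec X y).card = k p) ∧ (0 < k p →
        (1 + η) * (1 - α) * Real.logb 2 (p.choose (k p) : ℝ) ≤ (n p : ℝ) →
        ENNReal.ofReal (1 - δ p) ≤ GroupTesting.successProb (hkp p) D dec α) := by
    intro p
    by_cases hp : 0 < k p ∧ (1 + η) * (1 - α) * Real.logb 2 (p.choose (k p) : ℝ) ≤ (n p : ℝ)
    · have hp0 : (0 : ℝ) < p := by exact_mod_cast hp.1.trans_le (hkp p)
      have hk0 : (0 : ℝ) < k p := by exact_mod_cast hp.1
      have hlog : 0 ≤ k p * Real.logb 2 (1 / ((k p : ℝ) / p)) := by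
        refine mul_nonneg hk0.le (Real.logb_nonneg (by norm_num) ?_)
        rw [one_div_div, one_le_div hk0]
        exact_mod_cast hkp p
      have hnp : (1 + h) * ((θ + ε) * k p) * Real.logb 2 (1 / ((k p : ℝ) / p)) ≤ n p :=
        calc (1 + h) * ((θ + ε) * k p) * Real.logb 2 (1 / ((k p : ℝ) / p))
            = (1 + h) * (θ + ε) * (k p * Real.logb 2 (1 / ((k p : ℝ) / p))) := by ring
          _ ≤ (1 + η) * (1 - α) * (k p * Real.logb 2 (1 / ((k p : ℝ) / p))) :=
            mul_le_mul_of_nonneg_right hrate hlog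
          _ ≤ (1 + η) * (1 - α) * Real.logb 2 (p.choose (k p) : ℝ) :=
            mul_le_mul_of_nonneg_left (GroupTesting.mul_logb_le_logb_choose hp.1 (hkp p))
              (mul_nonneg (by linarith) (by linarith))
          _ ≤ n p := hp.2
      obtain ⟨X, dec, hdec, hbad⟩ :=
        GroupTesting.exists_matrix_decoder hp.1 (hkp p) hθ hε hθε hα hh hγ hnp
      exact ⟨PMF.pure X, fun _ => dec, fun _ => hdec, fun _ _ =>
        GroupTesting.le_successProb_pure (hkp p) X (fun _ => dec) hbad⟩
    · obtain ⟨V, -, hV⟩ := Finset.exists_superset_card_eq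
        (by simp : (∅ : Finset (Fin p)).card ≤ k p)
        (by simpa using hkp p : k p ≤ Fintype.card (Fin p))
      exact ⟨PMF.pure fun _ _ => false, fun _ _ => V, fun _ _ => hV,
        fun h1 h2 => absurd ⟨h1, h2⟩ hp⟩
  choose D dec hdec hsucc using hgood
  refine ⟨D, dec, hdec, ?_⟩
  have hkR : Tendsto (fun p => (k p : ℝ)) atTop atTop := tendsto_natCast_atTop_atTop.comp hk
  have hk1 : ∀ᶠ p in atTop, 0 < k p := hk.eventually_gt_atTop 0
  have hδ1 : Tendsto (fun p => 1 / (ε ^ 2 * (k p : ℝ))) atTop (𝓝 0) :=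
    (hkR.const_mul_atTop (by positivity)).const_div_atTop 1
  have hρ : Tendsto (fun p : ℕ => 2 * Real.exp 1 * ((k p : ℝ) / p) ^ γ) atTop (𝓝 0) := by
    have := (hko.tendsto_div_nhds_zero.rpow_const (Or.inr hγ0.le)).const_mul (2 * Real.exp 1)
    rwa [Real.zero_rpow hγ0.ne', mul_zero] at this
  have hδ2 : Tendsto (fun p : ℕ => (2 * Real.exp 1 * ((k p : ℝ) / p) ^ γ) ^ k p) atTop (𝓝 0) := by
    -- Once the base is at most 1, a positive power is bounded by the base itself.
    refine squeeze_zero' (Eventually.of_forall fun p => by positivity) ?_ hρ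
    filter_upwards [hk1, hρ.eventually_le_const one_pos] with p hp hp1
    exact pow_le_of_le_one (by positivity) hp1 hp.ne'
  have hδ : Tendsto (fun p => ENNReal.ofReal (1 - δ p)) atTop (𝓝 1) := by
    have := ENNReal.tendsto_ofReal ((hδ1.add hδ2).const_sub 1)
    rwa [add_zero, sub_zero, ENNReal.ofReal_one] at this
  refine tendsto_of_tendsto_of_tendsto_of_le_of_le' hδ tendsto_const_nhds ?_
    (Eventually.of_forall fun p => GroupTesting.successProb_le_one _ _ _ _)
  filter_upwards [hk1, hn] with p hp hnp
  exact hsucc p hp hnp
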